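/- Let $d_0,d_1,d_2,N$ be natural numbers, $X\in\mathbb{R}^{d_0\times N}$, $Y\in\mathbb{R}^{d_2\times N}$, and define, for $W_1\in\mathbb{R}^{d_1\times d_0}$ and $W_2\in\mathbb{R}^{d_2\times d_1}$, \[ f(W_1,W_2)=\tfrac12\|W_2W_1X-Y\|_F^2,\qquad g(W_1,W_2)=\tfrac12\|W_2W_1X-Y\|_F^2+\tfrac{\mu}{4}\,\|W_2^{\mathrm T}W_2-W_1XX^{\mathrm T}W_1^{\mathrm T}\|_F^2 . \] Assume that $XX^{\mathrm T}$ has full row rank, i.e. $\operatorname{rank}(XX^{\mathrm T})=d_0$. Then for every $\mu>0$: (i) both $f$ and $g$ attain a global minimum, and their global minimum values are equal; (ii) every critical point $(W_1,W_2)$ of $g$ (a point where all first partial derivatives of $g$ with respect to the entries of $W_1$ and $W_2$ vanish) is also a critical point of $f$; (iii) $g$ has no spurious local minima, i.e. every local minimum of $g$ is a global minimum; and at every saddle point of $g$, i.e. every critical point of $g$ that is not a local minimum, the Hessian of $g$ (the matrix of its second partial derivatives with respect to all entries of $W_1$ and $W_2$) has a strictly negative eigenvalue. -/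

import Mathlib

noncomputable section

open scoped Matrix

/-- The Frobenius norm of a real matrix. -/
def frobeniusNorm {m n : Type*} [Fintype m] [Fintype n] (A : Matrix m n ℝ) : ℝ :=
  Matrix.frobeniusNormedAddCommGroup.toNorm.norm A

/-- The pairs `(W₁, W₂)` of weight matrices of a network with layer sizes `d₀`, `d₁`, `d₂`. -/
abbrev Weights (d₀ d₁ d₂ : ℕ) : Type :=
  Matrix (Fin d₁) (Fin d₀) ℝ × Matrix (Fin d₂) (Fin d₁) ℝ

/-- The indices of the scalar entries of `(W₁, W₂)`: the entries of `W₁`, then those of `W₂`. -/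
abbrev WeightIndex (d₀ d₁ d₂ : ℕ) : Type :=
  (Fin d₁ × Fin d₀) ⊕ (Fin d₂ × Fin d₁)

/-- The direction in which only the entry with index `a` varies, at unit speed. -/
def entryDir {d₀ d₁ d₂ : ℕ} : WeightIndex d₀ d₁ d₂ → Weights d₀ d₁ d₂
  | Sum.inl (i, j) => (Matrix.single i j 1, 0)
  | Sum.inr (i, j) => (0, Matrix.single i j 1)

/-- The partial derivative of `h` with respect to the entry with index `a`. -/
def entryDeriv {d₀ d₁ d₂ : ℕ} (h : Weights d₀ d₁ d₂ → ℝ) (a : WeightIndex d₀ d₁ d₂) :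
    Weights d₀ d₁ d₂ → ℝ :=
  fun W => lineDeriv ℝ h W (entryDir a)

/-- `W` is a critical point of `h`: every first partial derivative exists and vanishes at `W`. -/
def IsCriticalPt {d₀ d₁ d₂ : ℕ} (h : Weights d₀ d₁ d₂ → ℝ) (W : Weights d₀ d₁ d₂) : Prop :=
  ∀ a : WeightIndex d₀ d₁ d₂, HasLineDerivAt ℝ h 0 W (entryDir a)

/-- The Hessian matrix of `h` at `W`: the matrix of second partial derivatives. -/
def hessianMatrix {d₀ d₁ d₂ : ℕ} (h : Weights d₀ d₁ d₂ → ℝ) (W : Weights d₀ d₁ d₂) :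
    Matrix (WeightIndex d₀ d₁ d₂) (WeightIndex d₀ d₁ d₂) ℝ :=
  Matrix.of fun a b => entryDeriv (entryDeriv h b) a W

/-- `W` is a global minimum of `h`. -/
def IsGlobalMin {d₀ d₁ d₂ : ℕ} (h : Weights d₀ d₁ d₂ → ℝ) (W : Weights d₀ d₁ d₂) : Prop :=
  ∀ W' : Weights d₀ d₁ d₂, h W ≤ h W'

/-- A spurious local minimum: a local minimum that is not a global minimum. -/
def IsSpuriousLocalMin {d₀ d₁ d₂ : ℕ} (h : Weights d₀ d₁ d₂ → ℝ) (W : Weights d₀ d₁ d₂) : Prop :=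
  IsLocalMin h W ∧ ¬ IsGlobalMin h W

/-- A saddle point: a critical point that is not a local minimum (local maxima that are not local
minima are included). -/
def IsSaddlePt {d₀ d₁ d₂ : ℕ} (h : Weights d₀ d₁ d₂ → ℝ) (W : Weights d₀ d₁ d₂) : Prop :=
  IsCriticalPt h W ∧ ¬ IsLocalMin h W

/-- The square loss `f(W₁, W₂) = ½ ‖W₂ W₁ X - Y‖²` of the shallow linear network. -/
def squareLoss {d₀ d₂ N : ℕ} (d₁ : ℕ) (X : Matrix (Fin d₀) (Fin N) ℝ)
    (Y : Matrix (Fin d₂) (Fin N) ℝ) (W : Weights d₀ d₁ d₂) : ℝ :=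
  1 / 2 * frobeniusNorm (W.2 * W.1 * X - Y) ^ 2

/-- The regularizer `ρ(W₁, W₂) = ‖W₂ᵀ W₂ - W₁ X Xᵀ W₁ᵀ‖²`. -/
def balanceReg {d₀ d₁ d₂ N : ℕ} (X : Matrix (Fin d₀) (Fin N) ℝ) (W : Weights d₀ d₁ d₂) : ℝ :=
  frobeniusNorm (W.2ᵀ * W.2 - W.1 * X * Xᵀ * W.1ᵀ) ^ 2

/-- The regularized loss `g = f + (μ / 4) ρ`. -/
def regLoss {d₀ d₂ N : ℕ} (d₁ : ℕ) (X : Matrix (Fin d₀) (Fin N) ℝ)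
    (Y : Matrix (Fin d₂) (Fin N) ℝ) (μ : ℝ) (W : Weights d₀ d₁ d₂) : ℝ :=
  squareLoss d₁ X Y W + μ / 4 * balanceReg X W

end

open scoped Matrix

/-! ### Calculus of half the square of a quadratic map along lines. -/

section Calculus

variable {V M : Type*} [AddCommGroup V] [Module ℝ V] [AddCommGroup M] [Module ℝ M]

/-! Since `X * Xᵀ` is invertible, write it as `S * Sᵀ` with `S` invertible. With `A = W₁ S`, `B =
W₂` and a suitable `Z`, completing the square turns `g` into `½‖BA - Z‖² + (μ/4)‖BᵀB - AAᵀ‖²` plus a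
constant; `f` is the case `μ = 0` with the same `Z` and constant (`regLoss_eq_quarticMap`).

A critical point of `g` is balanced, `BᵀB = AAᵀ`: moving along the orbit that fixes `BA` to first
order detects only the regularizer (`balanced_of_stationary`). There the regularizer and its
gradient vanish, so the point is critical for `f` and the two values agree.

Let also the Hessian be nonnegative, and let `E = BA - Z` be nonzero with top singular value `σ`.
Criticality gives `BᵀE = 0` and `EAᵀ = 0`. A rank-one direction built from the top singular vector
yields `AAᵀ ≥ σ` (`singular_value_le_of_curvature_nonneg`). By balance, the nonzero singular values
of `BA` are the eigenvalues of `AAᵀ`, so `BA` is a truncated singular value decomposition of `Z`,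
hence a best approximation among all products `B'A'` (`frobInner_residual_le_of_curvature_nonneg`).
Thus `g` at such a point is at most `f` everywhere, and `f ≤ g`. Local minima are therefore global,
and a saddle must have a direction of negative curvature.

Minimizers exist because the regularizer makes `g` coercive in `(A, B)`
(`exists_forall_regularized_le`); a minimizer of `g` then also minimizes `f`. -/

theorem hasLineDerivAt_of_quartic_expansion {h : V → ℝ} {W U : V} {a b c d : ℝ}
    (hh : ∀ t : ℝ, h (W + t • U) = h W + t * a + t ^ 2 * b + t ^ 3 * c + t ^ 4 * d) :
    HasLineDerivAt ℝ h a W U := by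
  unfold HasLineDerivAt
  simp_rw [hh]
  have h1 := (((((hasDerivAt_id (0 : ℝ)).mul_const a).const_add (h W)).add
    (((hasDerivAt_id (0 : ℝ)).pow 2).mul_const b)).add
    (((hasDerivAt_id (0 : ℝ)).pow 3).mul_const c)).add
    (((hasDerivAt_id (0 : ℝ)).pow 4).mul_const d)
  refine HasDerivAt.congr_deriv h1 ?_
  simp

/-- Half the square of a quadratic map, for a bilinear form on the target, up to a constant. -/
noncomputable def quarticMap (q : V →ₗ[ℝ] V →ₗ[ℝ] M) (β : M →ₗ[ℝ] M →ₗ[ℝ] ℝ) (z : M) (k : ℝ)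
    (W : V) : ℝ :=
  1 / 2 * β (q W W - z) (q W W - z) + k

/-- The differential of `quarticMap`. -/
noncomputable def quarticGrad (q : V →ₗ[ℝ] V →ₗ[ℝ] M) (β : M →ₗ[ℝ] M →ₗ[ℝ] ℝ) (z : M) (W : V) :
    V →ₗ[ℝ] ℝ :=
  (2 : ℝ) • (β (q W W - z)).comp (q W)

/-- The second differential of `quarticMap`. -/
noncomputable def quarticHess (q : V →ₗ[ℝ] V →ₗ[ℝ] M) (β : M →ₗ[ℝ] M →ₗ[ℝ] ℝ) (z : M) (W : V) :
    V →ₗ[ℝ] V →ₗ[ℝ] ℝ :=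
  (4 : ℝ) • β.compl₁₂ (q W) (q W) + (2 : ℝ) • q.compr₂ (β (q W W - z))

variable {q : V →ₗ[ℝ] V →ₗ[ℝ] M} {β : M →ₗ[ℝ] M →ₗ[ℝ] ℝ} {z : M} {k : ℝ}

theorem quarticGrad_apply (W U : V) :
    quarticGrad q β z W U = 2 * β (q W W - z) (q W U) := rfl

theorem quarticHess_apply (W U U' : V) :
    quarticHess q β z W U U' = 4 * β (q W U) (q W U') + 2 * β (q W W - z) (q U U') := rfl

theorem quarticHess_comm (hq : ∀ x y, q x y = q y x) (hβ : ∀ x y, β x y = β y x) (W U U' : V) :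
    quarticHess q β z W U U' = quarticHess q β z W U' U := by
  rw [quarticHess_apply, quarticHess_apply, hβ (q W U), hq U]

theorem quarticMap_expansion (hq : ∀ x y, q x y = q y x) (hβ : ∀ x y, β x y = β y x)
    (W U : V) (t : ℝ) :
    quarticMap q β z k (W + t • U) = quarticMap q β z k W + t * quarticGrad q β z W U
      + t ^ 2 * (quarticHess q β z W U U / 2) + t ^ 3 * (2 * β (q W U) (q U U))
      + t ^ 4 * (1 / 2 * β (q U U) (q U U)) := by
  have e : q (W + t • U) (W + t • U) - z
      = (q W W - z) + (2 * t) • q W U + t ^ 2 • q U U := by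
    simp only [map_add, map_smul, LinearMap.add_apply, LinearMap.smul_apply, hq U W]
    module
  rw [quarticMap, e, quarticMap, quarticGrad_apply, quarticHess_apply]
  generalize q W W - z = w
  simp only [map_add, map_smul, LinearMap.add_apply, LinearMap.smul_apply, smul_eq_mul,
    hβ (q W U) w, hβ (q U U) w, hβ (q U U) (q W U)]
  ring

/-- The vanishing last term only matches the shape required by
`hasLineDerivAt_of_quartic_expansion`. -/
theorem quarticGrad_expansion (hq : ∀ x y, q x y = q y x)
    (W U U' : V) (t : ℝ) :
    quarticGrad q β z (W + t • U) U' = quarticGrad q β z W U' + t * quarticHess q β z W U U'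
      + t ^ 2 * (2 * β (q U U) (q W U') + 4 * β (q W U) (q U U'))
      + t ^ 3 * (2 * β (q U U) (q U U')) + t ^ 4 * 0 := by
  have e : q (W + t • U) (W + t • U) - z
      = (q W W - z) + (2 * t) • q W U + t ^ 2 • q U U := by
    simp only [map_add, map_smul, LinearMap.add_apply, LinearMap.smul_apply, hq U W]
    module
  rw [quarticGrad_apply, e, quarticGrad_apply, quarticHess_apply]
  generalize q W W - z = w
  simp only [map_add, map_smul, LinearMap.add_apply, LinearMap.smul_apply, smul_eq_mul]
  ring

theorem hasLineDerivAt_quarticMap (hq : ∀ x y, q x y = q y x) (hβ : ∀ x y, β x y = β y x)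
    (W U : V) : HasLineDerivAt ℝ (quarticMap q β z k) (quarticGrad q β z W U) W U :=
  hasLineDerivAt_of_quartic_expansion (quarticMap_expansion hq hβ W U)

theorem hasLineDerivAt_quarticGrad (hq : ∀ x y, q x y = q y x)
    (W U U' : V) :
    HasLineDerivAt ℝ (fun W => quarticGrad q β z W U') (quarticHess q β z W U U') W U :=
  hasLineDerivAt_of_quartic_expansion (h := fun W => quarticGrad q β z W U')
    (quarticGrad_expansion hq W U U')

variable [TopologicalSpace V] [ContinuousAdd V] [ContinuousSMul ℝ V]

theorem IsLocalMin.comp_line {h : V → ℝ} {W : V} (hW : IsLocalMin h W) (U : V) :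
    IsLocalMin (fun t : ℝ => h (W + t • U)) 0 := by
  have hc : ContinuousAt (fun t : ℝ => W + t • U) 0 := by fun_prop
  have : Filter.Tendsto (fun t : ℝ => W + t • U) (nhds 0) (nhds W) := by
    simpa [ContinuousAt] using hc
  have h2 := this.eventually hW
  unfold IsLocalMin IsMinFilter
  simpa using h2

theorem quarticGrad_eq_zero_of_isLocalMin (hq : ∀ x y, q x y = q y x)
    (hβ : ∀ x y, β x y = β y x) {W : V} (hW : IsLocalMin (quarticMap q β z k) W) (U : V) :
    quarticGrad q β z W U = 0 :=
  (hW.comp_line U).hasDerivAt_eq_zero (hasLineDerivAt_quarticMap hq hβ W U)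

theorem quarticHess_nonneg_of_isLocalMin (hq : ∀ x y, q x y = q y x)
    (hβ : ∀ x y, β x y = β y x) {W : V} (hW : IsLocalMin (quarticMap q β z k) W) (U : V) :
    0 ≤ quarticHess q β z W U U := by
  have hg := quarticGrad_eq_zero_of_isLocalMin hq hβ hW U
  have hm := hW.comp_line U
  set b := quarticHess q β z W U U
  set c := 2 * β (q W U) (q U U)
  set d := 1 / 2 * β (q U U) (q U U)
  have hlim : Filter.Tendsto (fun t : ℝ => b / 2 + t * c + t ^ 2 * d) (nhdsWithin 0 {0}ᶜ)
      (nhds (b / 2)) := by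
    have : ContinuousAt (fun t : ℝ => b / 2 + t * c + t ^ 2 * d) 0 := by fun_prop
    have h2 : Filter.Tendsto (fun t : ℝ => b / 2 + t * c + t ^ 2 * d) (nhds 0)
        (nhds (b / 2)) := by simpa [ContinuousAt] using this
    exact h2.mono_left nhdsWithin_le_nhds
  -- The linear term vanishes, so the increment along the line is `t ^ 2` times this expression;
  -- dividing and letting `t → 0` leaves `b / 2`.
  have hev : ∀ᶠ t : ℝ in nhdsWithin 0 {0}ᶜ, 0 ≤ b / 2 + t * c + t ^ 2 * d := by
    filter_upwards [hm.filter_mono nhdsWithin_le_nhds, self_mem_nhdsWithin] with t ht h0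
    have h3 : quarticMap q β z k (W + t • U) = quarticMap q β z k W + t * 0
        + t ^ 2 * (b / 2) + t ^ 3 * c + t ^ 4 * d := by
      rw [quarticMap_expansion hq hβ, hg]
    simp only [zero_smul, add_zero] at ht
    have h0' : 0 < t ^ 2 := by
      have : t ≠ 0 := h0
      positivity
    have : 0 ≤ t ^ 2 * (b / 2 + t * c + t ^ 2 * d) := by
      have : t ^ 2 * (b / 2 + t * c + t ^ 2 * d)
        = t * 0 + t ^ 2 * (b / 2) + t ^ 3 * c + t ^ 4 * d := by ring
      linarith only [h3, ht, this]
    exact nonneg_of_mul_nonneg_right this h0'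
  have := ge_of_tendsto hlim hev
  linarith

end Calculus

/-! ### From entrywise derivatives to gradient and Hessian forms. -/

section Weights

variable {d₀ d₁ d₂ : ℕ}

/-- The vector of all entries of a pair of weight matrices. -/
def weightsEntries (W : Weights d₀ d₁ d₂) : WeightIndex d₀ d₁ d₂ → ℝ
  | Sum.inl (i, j) => W.1 i j
  | Sum.inr (i, j) => W.2 i j

theorem sum_smul_entryDir (W : Weights d₀ d₁ d₂) :
    ∑ a, weightsEntries W a • entryDir a = W := by
  rw [Fintype.sum_sum_type]
  ext i j
  · simp only [Prod.fst_add, Prod.fst_sum, Prod.smul_fst, entryDir, weightsEntries, smul_zero,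
      Finset.sum_const_zero, add_zero, Fintype.sum_prod_type, Matrix.smul_single, smul_eq_mul,
      mul_one]
    rw [← Matrix.matrix_eq_sum_single]
  · simp only [Prod.snd_add, Prod.snd_sum, Prod.smul_snd, entryDir, weightsEntries, smul_zero,
      Finset.sum_const_zero, zero_add, Fintype.sum_prod_type, Matrix.smul_single, smul_eq_mul,
      mul_one]
    rw [← Matrix.matrix_eq_sum_single]

variable {M : Type*} [AddCommGroup M] [Module ℝ M]
variable {q : Weights d₀ d₁ d₂ →ₗ[ℝ] Weights d₀ d₁ d₂ →ₗ[ℝ] M} {β : M →ₗ[ℝ] M →ₗ[ℝ] ℝ}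
  {z : M} {k : ℝ}

theorem isCriticalPt_quarticMap_iff (hq : ∀ x y, q x y = q y x) (hβ : ∀ x y, β x y = β y x)
    (W : Weights d₀ d₁ d₂) :
    IsCriticalPt (quarticMap q β z k) W ↔ ∀ U, quarticGrad q β z W U = 0 := by
  constructor
  · intro h U
    rw [← sum_smul_entryDir U, map_sum]
    refine Finset.sum_eq_zero fun a _ => ?_
    rw [map_smul, (hasLineDerivAt_quarticMap hq hβ W (entryDir a)).unique (h a), smul_zero]
  · intro h a
    rw [← h (entryDir a)]
    exact hasLineDerivAt_quarticMap hq hβ W (entryDir a)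

theorem hessianMatrix_quarticMap (hq : ∀ x y, q x y = q y x) (hβ : ∀ x y, β x y = β y x)
    (W : Weights d₀ d₁ d₂) (a b : WeightIndex d₀ d₁ d₂) :
    hessianMatrix (quarticMap q β z k) W a b
      = quarticHess q β z W (entryDir a) (entryDir b) := by
  have h1 : entryDeriv (quarticMap q β z k) b = fun W => quarticGrad q β z W (entryDir b) := by
    funext W
    exact (hasLineDerivAt_quarticMap hq hβ W (entryDir b)).lineDeriv
  rw [hessianMatrix, Matrix.of_apply, h1]
  exact (hasLineDerivAt_quarticGrad hq W (entryDir a) (entryDir b)).lineDeriv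

theorem Matrix.exists_neg_eigenvalue_of_dotProduct_neg {n : Type*} [Fintype n] [DecidableEq n]
    {H : Matrix n n ℝ} (hH : H.IsHermitian) {x : n → ℝ} (hx : x ⬝ᵥ (H *ᵥ x) < 0) :
    ∃ c : ℝ, c < 0 ∧ Module.End.HasEigenvalue (Matrix.toLin' H) c := by
  have : ¬ H.PosSemidef := fun h => by
    have := h.dotProduct_mulVec_nonneg x
    simp only [star_trivial] at this
    linarith
  rw [hH.posSemidef_iff_eigenvalues_nonneg, Pi.le_def] at this
  push Not at this
  obtain ⟨i, hi⟩ := this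
  refine ⟨hH.eigenvalues i, hi, ?_⟩
  have h1 := hH.mulVec_eigenvectorBasis i
  refine Module.End.hasEigenvalue_of_hasEigenvector (x := (hH.eigenvectorBasis i).ofLp) ?_
  refine ⟨Module.End.mem_eigenspace_iff.2 (by simpa using h1), ?_⟩
  have := hH.eigenvectorBasis.orthonormal.ne_zero i
  simpa using this

/-- The quadratic form of the Hessian matrix at the entries of `U` is the second differential at
`U`, so one direction of negative curvature suffices. -/
theorem exists_neg_eigenvalue_hessianMatrix (hq : ∀ x y, q x y = q y x)
    (hβ : ∀ x y, β x y = β y x) {W U : Weights d₀ d₁ d₂} (hU : quarticHess q β z W U U < 0) :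
    ∃ c : ℝ, c < 0 ∧
      Module.End.HasEigenvalue (Matrix.toLin' (hessianMatrix (quarticMap q β z k) W)) c := by
  refine Matrix.exists_neg_eigenvalue_of_dotProduct_neg (x := weightsEntries U) ?_ ?_
  · ext a b
    rw [Matrix.conjTranspose_apply, star_trivial, hessianMatrix_quarticMap hq hβ,
      hessianMatrix_quarticMap hq hβ, quarticHess_comm hq hβ]
  · refine lt_of_eq_of_lt ?_ hU
    conv_rhs => rw [← sum_smul_entryDir U]
    simp only [dotProduct, Matrix.mulVec, hessianMatrix_quarticMap hq hβ, map_sum, map_smul,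
      LinearMap.sum_apply, LinearMap.smul_apply, smul_eq_mul, Finset.mul_sum]
    rw [Finset.sum_comm]
    refine Finset.sum_congr rfl fun a _ => Finset.sum_congr rfl fun b _ => ?_
    ring

end Weights

/-! ### The Frobenius inner product. -/

section FrobeniusInner

variable {l m n : Type*} [Fintype l] [Fintype m] [Fintype n]

/-- The Frobenius inner product of real matrices. -/
def frobInner : Matrix m n ℝ →ₗ[ℝ] Matrix m n ℝ →ₗ[ℝ] ℝ :=
  LinearMap.mk₂ ℝ (fun A B => (Aᵀ * B).trace)
    (fun A B C => by rw [Matrix.transpose_add, Matrix.add_mul, Matrix.trace_add])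
    (fun c A B => by rw [Matrix.transpose_smul, Matrix.smul_mul, Matrix.trace_smul])
    (fun A B C => by rw [Matrix.mul_add, Matrix.trace_add])
    (fun c A B => by rw [Matrix.mul_smul, Matrix.trace_smul])

theorem frobInner_apply (A B : Matrix m n ℝ) : frobInner A B = (Aᵀ * B).trace := rfl

theorem frobInner_comm (A B : Matrix m n ℝ) : frobInner A B = frobInner B A := by
  rw [frobInner_apply, ← Matrix.trace_transpose, Matrix.transpose_mul, Matrix.transpose_transpose,
    frobInner_apply]

theorem frobInner_transpose (A B : Matrix m n ℝ) : frobInner Aᵀ Bᵀ = frobInner A B := by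
  rw [frobInner_comm A B, frobInner_apply, frobInner_apply, Matrix.transpose_transpose,
    Matrix.trace_mul_comm]

theorem frobInner_mul_left (A : Matrix l m ℝ) (B : Matrix m n ℝ) (C : Matrix l n ℝ) :
    frobInner C (A * B) = frobInner (Aᵀ * C) B := by
  rw [frobInner_apply, frobInner_apply, Matrix.transpose_mul, Matrix.transpose_transpose,
    Matrix.mul_assoc]

theorem frobInner_mul_right (A : Matrix l m ℝ) (B : Matrix m n ℝ) (C : Matrix l n ℝ) :
    frobInner C (A * B) = frobInner (C * Bᵀ) A := by
  rw [← frobInner_transpose, Matrix.transpose_mul, frobInner_mul_left, ← frobInner_transpose,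
    Matrix.transpose_mul]
  simp only [Matrix.transpose_transpose]

theorem frobInner_self (A : Matrix m n ℝ) : frobInner A A = ∑ i, ∑ j, A i j ^ 2 := by
  rw [frobInner_apply, Matrix.trace, Finset.sum_comm]
  simp [Matrix.mul_apply, sq]

theorem frobInner_self_nonneg (A : Matrix m n ℝ) : 0 ≤ frobInner A A := by
  rw [frobInner_self]
  positivity

theorem sq_le_frobInner_self (A : Matrix m n ℝ) (i : m) (j : n) :
    A i j ^ 2 ≤ frobInner A A := by
  rw [frobInner_self]
  refine le_trans ?_ (Finset.single_le_sum (f := fun i => ∑ j, A i j ^ 2)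
    (fun i _ => by positivity) (Finset.mem_univ i))
  exact Finset.single_le_sum (f := fun j => A i j ^ 2) (fun j _ => by positivity)
    (Finset.mem_univ j)

theorem frobInner_self_eq_zero {A : Matrix m n ℝ} (h : frobInner A A = 0) : A = 0 := by
  ext i j
  have := sq_le_frobInner_self A i j
  rw [h] at this
  exact pow_eq_zero_iff two_ne_zero |>.1 (le_antisymm this (sq_nonneg _))

theorem frobeniusNorm_sq (A : Matrix m n ℝ) : frobeniusNorm A ^ 2 = frobInner A A := by
  have h : frobeniusNorm A = (∑ i, ∑ j, ‖A i j‖ ^ (2 : ℝ)) ^ (1 / 2 : ℝ) :=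
    Matrix.frobenius_norm_def A
  rw [h, ← Real.sqrt_eq_rpow, Real.sq_sqrt (by positivity), frobInner_self]
  simp

end FrobeniusInner

/-! ### First-order conditions: balance and orthogonality of the residual. -/

section Stationary

variable {l m n : Type*} [Fintype l] [Fintype m] [Fintype n]

theorem balanced_of_stationary {A : Matrix m n ℝ} {B : Matrix l m ℝ} {Z : Matrix l n ℝ} {μ : ℝ}
    (hμ : 0 < μ)
    (h : ∀ (U : Matrix m n ℝ) (V : Matrix l m ℝ), frobInner (B * A - Z) (B * U + V * A)
      + μ / 2 * frobInner (Bᵀ * B - A * Aᵀ) (Bᵀ * V + Vᵀ * B - A * Uᵀ - U * Aᵀ) = 0) :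
    Bᵀ * B = A * Aᵀ := by
  set D := Bᵀ * B - A * Aᵀ with hD
  have hDt : Dᵀ = D := by simp [hD]
  -- Velocity at `t = 0` of `(exp(-tD) A, B exp(tD))`, along which the product `BA` is constant. The
  -- residual term drops out, leaving a multiple of `‖BD‖² + ‖DA‖²`.
  have h1 := h (-(D * A)) (B * D)
  have e1 : B * -(D * A) + B * D * A = 0 := by
    rw [Matrix.mul_neg, Matrix.mul_assoc, neg_add_cancel]
  have e2 : frobInner D (Bᵀ * (B * D)) = frobInner (B * D) (B * D) := by
    rw [frobInner_mul_left, Matrix.transpose_transpose]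
  have e3 : frobInner D ((B * D)ᵀ * B) = frobInner (B * D) (B * D) := by
    rw [← frobInner_transpose, Matrix.transpose_mul, Matrix.transpose_transpose, hDt, e2]
  have e4 : frobInner D (D * A * Aᵀ) = frobInner (D * A) (D * A) := by
    rw [frobInner_mul_right, Matrix.transpose_transpose]
  have e5 : frobInner D (A * (D * A)ᵀ) = frobInner (D * A) (D * A) := by
    rw [← frobInner_transpose, Matrix.transpose_mul, Matrix.transpose_transpose, hDt, e4]
  rw [e1, map_zero, zero_add] at h1
  simp only [Matrix.transpose_neg, Matrix.mul_neg, Matrix.neg_mul, sub_neg_eq_add, map_add,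
    e2, e3, e4, e5] at h1
  have hB := frobInner_self_nonneg (B * D)
  have hA := frobInner_self_nonneg (D * A)
  have hs : frobInner (B * D) (B * D) + frobInner (D * A) (D * A) = 0 := by
    rcases mul_eq_zero.1 h1 with h2 | h2
    · linarith
    · linarith
  have hBD := frobInner_self_eq_zero (le_antisymm (by linarith) hB)
  have hDA := frobInner_self_eq_zero (le_antisymm (by linarith) hA)
  -- Expanding only the second `D` gives `⟨DBᵀ, Bᵀ⟩ - ⟨DA, A⟩`, and both products with `D` are zero.
  have : frobInner D D = 0 := by
    conv_lhs => enter [2]; rw [hD]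
    rw [map_sub, frobInner_mul_right, frobInner_mul_right, Matrix.transpose_transpose, hDA,
      ← hDt, ← Matrix.transpose_mul, hBD]
    simp
  exact sub_eq_zero.1 (frobInner_self_eq_zero this)

theorem transpose_mul_eq_zero_of_stationary {A : Matrix m n ℝ} {B : Matrix l m ℝ}
    {E : Matrix l n ℝ}
    (h : ∀ (U : Matrix m n ℝ) (V : Matrix l m ℝ), frobInner E (B * U + V * A) = 0) :
    Bᵀ * E = 0 ∧ E * Aᵀ = 0 := by
  constructor
  · have := h (Bᵀ * E) 0
    rw [Matrix.zero_mul, add_zero, frobInner_mul_left] at this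
    exact frobInner_self_eq_zero this
  · have := h 0 (E * Aᵀ)
    rw [Matrix.mul_zero, zero_add, frobInner_mul_right] at this
    exact frobInner_self_eq_zero this

end Stationary

/-! ### Spectral tools: top singular value, row-space projection, invertible factor. -/

section LowRank

variable {l m n : Type*} [Fintype l] [Fintype m] [Fintype n]

theorem Matrix.exists_top_singular_value [DecidableEq n] {E : Matrix l n ℝ} (hE : E ≠ 0) :
    ∃ (σ : ℝ) (u : n → ℝ), 0 < σ ∧ u ≠ 0 ∧ (Eᵀ * E) *ᵥ u = σ ^ 2 • u ∧
      (σ ^ 2 • (1 : Matrix n n ℝ) - Eᵀ * E).PosSemidef := by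
  have hP : (Eᵀ * E).PosSemidef := Matrix.posSemidef_conjTranspose_mul_self E
  have hH := hP.isHermitian
  have hne : hH.eigenvalues ≠ 0 := fun h => by
    have h0 := hH.eigenvalues_eq_zero_iff.1 h
    exact hE (frobInner_self_eq_zero (by rw [frobInner_apply, h0, Matrix.trace_zero]))
  obtain ⟨j, hj⟩ := Function.ne_iff.1 hne
  obtain ⟨i, -, hi⟩ := Finset.exists_max_image Finset.univ hH.eigenvalues ⟨j, Finset.mem_univ j⟩
  have hpos : 0 < hH.eigenvalues i :=
    lt_of_lt_of_le (lt_of_le_of_ne (hP.eigenvalues_nonneg j) (Ne.symm hj))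
      (hi j (Finset.mem_univ j))
  refine ⟨√(hH.eigenvalues i), (hH.eigenvectorBasis i).ofLp, Real.sqrt_pos.2 hpos, ?_, ?_, ?_⟩
  · simpa using hH.eigenvectorBasis.orthonormal.ne_zero i
  · rw [Real.sq_sqrt hpos.le]
    exact hH.mulVec_eigenvectorBasis i
  · rw [Real.sq_sqrt hpos.le]
    have hD : (Matrix.diagonal fun k => hH.eigenvalues i - hH.eigenvalues k).PosSemidef :=
      Matrix.PosSemidef.diagonal fun k => sub_nonneg.2 (hi k (Finset.mem_univ k))
    have := hD.mul_mul_conjTranspose_same (hH.eigenvectorUnitary : Matrix n n ℝ)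
    convert this using 1
    have e : (Matrix.diagonal fun k => hH.eigenvalues i - hH.eigenvalues k)
        = hH.eigenvalues i • 1 - Matrix.diagonal hH.eigenvalues := by
      rw [Matrix.smul_one_eq_diagonal, Matrix.diagonal_sub]
    rw [e, Matrix.mul_sub, Matrix.sub_mul, Matrix.mul_smul, Matrix.smul_mul, Matrix.mul_one]
    have h1 := Unitary.mul_star_self_of_mem hH.eigenvectorUnitary.2
    rw [Matrix.star_eq_conjTranspose] at h1
    rw [h1]
    exact congrArg _ hH.spectral_theorem

/-- The spectral projection of `Cᵀ * C` onto its nonzero eigenvalues; its trace counts them. -/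
theorem Matrix.exists_rowSpace_projection [DecidableEq n] (C : Matrix l n ℝ) :
    ∃ Q : Matrix n n ℝ, Qᵀ = Q ∧ Q * Q = Q ∧ C * Q = C ∧ Q.trace = C.rank := by
  have hP : (Cᵀ * C).PosSemidef := Matrix.posSemidef_conjTranspose_mul_self C
  have hH := hP.isHermitian
  set O : Matrix n n ℝ := (hH.eigenvectorUnitary : Matrix n n ℝ) with hO
  have h1 : Oᵀ * O = 1 := Unitary.star_mul_self_of_mem hH.eigenvectorUnitary.2
  have hs : Cᵀ * C = O * Matrix.diagonal hH.eigenvalues * Oᵀ := by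
    conv_lhs => rw [hH.spectral_theorem]
    rfl
  set s : n → ℝ := fun i => if hH.eigenvalues i ≠ 0 then 1 else 0 with hsdef
  have key : ∀ a b : n → ℝ, O * Matrix.diagonal a * Oᵀ * (O * Matrix.diagonal b * Oᵀ)
      = O * Matrix.diagonal (fun i => a i * b i) * Oᵀ := fun a b => by
    rw [← Matrix.diagonal_mul_diagonal]
    calc _ = O * Matrix.diagonal a * (Oᵀ * O) * Matrix.diagonal b * Oᵀ := by
          simp only [Matrix.mul_assoc]
      _ = _ := by rw [h1, Matrix.mul_one]; simp only [Matrix.mul_assoc]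
  refine ⟨O * Matrix.diagonal s * Oᵀ, ?_, ?_, ?_, ?_⟩
  · simp [Matrix.mul_assoc]
  · rw [key]
    congr; funext i; simp [hsdef]
  · set Q := O * Matrix.diagonal s * Oᵀ
    have h2 : Cᵀ * C * Q = Cᵀ * C := by
      rw [hs, key]
      congr; funext i; by_cases h : hH.eigenvalues i = 0 <;> simp [hsdef, h]
    have h3 : Cᵀ * (C * Q - C) = 0 := by
      rw [Matrix.mul_sub, ← Matrix.mul_assoc, h2, sub_self]
    refine sub_eq_zero.1 (frobInner_self_eq_zero ?_)
    have h4 : C * Q - C = C * (Q - 1) := by rw [Matrix.mul_sub, Matrix.mul_one]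
    conv_lhs => enter [2]; rw [h4]
    rw [frobInner_mul_left, h3]
    simp
  · rw [Matrix.trace_mul_comm, ← Matrix.mul_assoc, h1, Matrix.one_mul, Matrix.trace_diagonal,
      ← Matrix.rank_transpose_mul_self, hH.rank_eq_card_non_zero_eigs, Fintype.card_subtype]
    simp only [hsdef, Finset.sum_boole]

theorem Matrix.exists_factor_of_rank_eq {d N : ℕ} {X : Matrix (Fin d) (Fin N) ℝ}
    (hX : (X * Xᵀ).rank = d) : ∃ S : Matrix (Fin d) (Fin d) ℝ, IsUnit S ∧ S * Sᵀ = X * Xᵀ := by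
  have hP : (X * Xᵀ).PosSemidef := Matrix.posSemidef_self_mul_conjTranspose X
  obtain ⟨R, hR⟩ : ∃ R : Matrix (Fin d) (Fin d) ℝ, X * Xᵀ = Rᵀ * R := by
    open scoped MatrixOrder in exact CStarAlgebra.nonneg_iff_eq_star_mul_self.mp hP.nonneg
  refine ⟨Rᵀ, ?_, by rw [Matrix.transpose_transpose, hR]⟩
  rw [hR, Matrix.rank_transpose_mul_self] at hX
  rw [Matrix.isUnit_transpose]
  rw [← Matrix.mulVec_surjective_iff_isUnit]
  exact LinearMap.range_eq_top.1 (Submodule.eq_top_of_finrank_eq (S := LinearMap.range R.mulVecLin)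
    (by simpa [Matrix.rank] using hX))

end LowRank

/-! ### Second-order conditions and optimality of the truncated decomposition. -/

section Curvature

variable {l m n : Type*} [Fintype l] [Fintype m] [Fintype n]

theorem frobInner_vecMulVec (a c : m → ℝ) (b d : n → ℝ) :
    frobInner (Matrix.vecMulVec a b) (Matrix.vecMulVec c d) = (a ⬝ᵥ c) * (b ⬝ᵥ d) := by
  rw [frobInner_apply, Matrix.transpose_vecMulVec, Matrix.vecMulVec_mul_vecMulVec,
    Matrix.trace_vecMulVec]
  simp

theorem frobInner_vecMulVec_right (E : Matrix m n ℝ) (c : m → ℝ) (d : n → ℝ) :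
    frobInner E (Matrix.vecMulVec c d) = c ⬝ᵥ (E *ᵥ d) := by
  rw [frobInner_apply, Matrix.mul_vecMulVec, Matrix.trace_vecMulVec, Matrix.mulVec_transpose,
    ← Matrix.dotProduct_mulVec]

variable {A : Matrix m n ℝ} {B : Matrix l m ℝ} {E : Matrix l n ℝ} {μ : ℝ}

theorem singular_value_le_of_curvature_nonneg (hBA : Bᵀ * B = A * Aᵀ) (hBE : Bᵀ * E = 0)
    (hEA : E * Aᵀ = 0)
    (h : ∀ (U : Matrix m n ℝ) (V : Matrix l m ℝ),
      0 ≤ frobInner (B * U + V * A) (B * U + V * A) + 2 * frobInner E (V * U)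
        + μ / 2 * frobInner (Bᵀ * V + Vᵀ * B - A * Uᵀ - U * Aᵀ)
          (Bᵀ * V + Vᵀ * B - A * Uᵀ - U * Aᵀ))
    {σ : ℝ} {u : n → ℝ} (hσ : 0 < σ) (hu : u ≠ 0) (hEu : (Eᵀ * E) *ᵥ u = σ ^ 2 • u) (p : m → ℝ) :
    σ * (p ⬝ᵥ p) ≤ p ⬝ᵥ ((A * Aᵀ) *ᵥ p) := by
  set e := E *ᵥ u with he
  have hBe : Bᵀ *ᵥ e = 0 := by rw [he, Matrix.mulVec_mulVec, hBE, Matrix.zero_mulVec]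
  have hAE : A * Eᵀ = 0 := by
    rw [← Matrix.transpose_transpose A, ← Matrix.transpose_mul, hEA, Matrix.transpose_zero]
  have hAu : A *ᵥ u = 0 := by
    have h1 : A *ᵥ ((Eᵀ * E) *ᵥ u) = 0 := by
      rw [Matrix.mulVec_mulVec, ← Matrix.mul_assoc, hAE, Matrix.zero_mul, Matrix.zero_mulVec]
    rw [hEu, Matrix.mulVec_smul] at h1
    exact (smul_eq_zero.1 h1).resolve_left (by positivity)
  have hee : e ⬝ᵥ e = σ ^ 2 * (u ⬝ᵥ u) := by
    rw [he, Matrix.dotProduct_mulVec, Matrix.vecMul_mulVec, ← Matrix.dotProduct_mulVec, hEu,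
      dotProduct_smul, smul_eq_mul]
  have huu : 0 < u ⬝ᵥ u := by
    have := Matrix.dotProduct_star_self_pos_iff.2 hu
    simpa using this
  have hBp : (B *ᵥ p) ⬝ᵥ (B *ᵥ p) = p ⬝ᵥ ((A * Aᵀ) *ᵥ p) := by
    rw [Matrix.dotProduct_mulVec, Matrix.vecMul_mulVec, ← Matrix.dotProduct_mulVec, hBA]
  have hAp : (p ᵥ* A) ⬝ᵥ (p ᵥ* A) = p ⬝ᵥ ((A * Aᵀ) *ᵥ p) := by
    rw [← Matrix.dotProduct_mulVec, ← Matrix.mulVec_transpose, Matrix.mulVec_mulVec]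
  have hBpe : (B *ᵥ p) ⬝ᵥ e = 0 := by
    rw [dotProduct_comm, Matrix.dotProduct_mulVec, ← Matrix.mulVec_transpose, hBe, zero_dotProduct]
  -- Since `Bᵀe = 0` and `Au = 0`, this direction leaves the balance unchanged to first order and
  -- the cross term vanishes. The factor `σ` equalizes the two squares, because `|e|² = σ²|u|²`; the
  -- residual term contributes `-2σ³|p|²|u|²`.
  have h1 := h (-σ • Matrix.vecMulVec p u) (Matrix.vecMulVec e p)
  have e1 : Bᵀ * Matrix.vecMulVec e p + (Matrix.vecMulVec e p)ᵀ * B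
      - A * (-σ • Matrix.vecMulVec p u)ᵀ - (-σ • Matrix.vecMulVec p u) * Aᵀ = 0 := by
    simp only [Matrix.transpose_smul, Matrix.transpose_vecMulVec, Matrix.mul_smul, Matrix.smul_mul,
      Matrix.mul_vecMulVec, Matrix.vecMulVec_mul, hBe, hAu, Matrix.vecMul_transpose]
    rw [← Matrix.mulVec_transpose, hBe]
    simp
  have e2 : Matrix.vecMulVec e p * (-σ • Matrix.vecMulVec p u)
      = (-σ * (p ⬝ᵥ p)) • Matrix.vecMulVec e u := by
    rw [Matrix.mul_smul, Matrix.vecMulVec_mul_vecMulVec, mul_smul]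
    simp [Matrix.vecMulVec_smul]
  have e3 : B * (-σ • Matrix.vecMulVec p u) + Matrix.vecMulVec e p * A
      = -σ • Matrix.vecMulVec (B *ᵥ p) u + Matrix.vecMulVec e (p ᵥ* A) := by
    rw [Matrix.mul_smul, Matrix.mul_vecMulVec, Matrix.vecMulVec_mul]
  rw [e1, e2, e3, map_smul, frobInner_vecMulVec_right, ← he, hee] at h1
  simp only [map_add, map_smul, LinearMap.add_apply, LinearMap.smul_apply, smul_eq_mul,
    frobInner_vecMulVec, hBp, hAp, hBpe, dotProduct_comm e (B *ᵥ p), hee, map_zero] at h1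
  have h2 : 0 ≤ (2 * σ ^ 2 * (u ⬝ᵥ u)) * (p ⬝ᵥ ((A * Aᵀ) *ᵥ p) - σ * (p ⬝ᵥ p)) := by
    linarith
  have := nonneg_of_mul_nonneg_right h2 (by positivity)
  linarith

/-- With `P = K + σ`, the matrix `P³ - σ²P` is a polynomial in `K ≥ 0` with nonnegative
coefficients; conjugating it by `P⁻¹` gives `P - σ²P⁻¹`. -/
theorem Matrix.IsHermitian.posSemidef_sub_smul_inv [DecidableEq m] {P : Matrix m m ℝ} {σ : ℝ}
    (hσ : 0 < σ) (hP : P.IsHermitian) (h : (P - σ • 1).PosSemidef) :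
    IsUnit P ∧ (P - σ ^ 2 • P⁻¹).PosSemidef := by
  set K := P - σ • (1 : Matrix m m ℝ) with hK
  have hPK : P = K + σ • 1 := by rw [hK, sub_add_cancel]
  have hpd : P.PosDef := by
    rw [hPK]
    exact Matrix.PosDef.posSemidef_add h (Matrix.PosDef.one.smul hσ)
  refine ⟨hpd.isUnit, ?_⟩
  have hdet := (Matrix.isUnit_iff_isUnit_det P).1 hpd.isUnit
  have hKs : (K ^ 3 + (3 * σ) • K ^ 2 + (2 * σ ^ 2) • K).PosSemidef :=
    ((h.pow 3).add ((h.pow 2).smul (by positivity))).add (h.smul (by positivity))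
  have h2 := hKs.conjTranspose_mul_mul_same P⁻¹
  have h3 : K ^ 3 + (3 * σ) • K ^ 2 + (2 * σ ^ 2) • K = P * P * P - σ ^ 2 • P := by
    rw [hPK]
    simp only [Matrix.mul_add, Matrix.add_mul, Matrix.mul_smul, Matrix.smul_mul, Matrix.mul_one,
      Matrix.one_mul, pow_succ, pow_zero]
    module
  have h4 : (P⁻¹)ᴴ = P⁻¹ := by rw [Matrix.conjTranspose_nonsing_inv, hP.eq]
  rw [h3, h4, Matrix.mul_sub, Matrix.sub_mul, Matrix.mul_smul, Matrix.smul_mul,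
    Matrix.mul_assoc P, Matrix.nonsing_inv_mul_cancel_left _ _ hdet,
    Matrix.nonsing_inv_mul _ hdet, Matrix.one_mul,
    Matrix.mul_nonsing_inv_cancel_right _ _ hdet] at h2
  exact h2

theorem Matrix.PosSemidef.trace_mul_projection_nonneg {R Q : Matrix n n ℝ} (hR : R.PosSemidef)
    (hQt : Qᵀ = Q) (hQ : Q * Q = Q) : 0 ≤ (R * Q).trace := by
  have := (hR.conjTranspose_mul_mul_same Q).trace_nonneg
  rwa [Matrix.conjTranspose_eq_transpose_of_trivial, hQt, Matrix.trace_mul_comm, ← Matrix.mul_assoc,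
    hQ, Matrix.trace_mul_comm] at this

/-- The inequality behind the optimality of a truncated singular value decomposition. -/
theorem trace_mul_projection_le [DecidableEq m] [DecidableEq n] {σ : ℝ} (hσ : 0 < σ)
    (hEA : E * Aᵀ = 0) (hA : (A * Aᵀ - σ • 1).PosSemidef)
    (hE : (σ ^ 2 • (1 : Matrix n n ℝ) - Eᵀ * E).PosSemidef) {Q : Matrix n n ℝ} (hQt : Qᵀ = Q)
    (hQ : Q * Q = Q) (hQr : Q.trace ≤ Fintype.card m) :
    ((Aᵀ * (A * Aᵀ) * A + Eᵀ * E) * Q).trace ≤ (Aᵀ * (A * Aᵀ) * A).trace := by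
  have hPh : (A * Aᵀ).IsHermitian := Matrix.isHermitian_mul_conjTranspose_self A
  obtain ⟨hu, hP⟩ := hPh.posSemidef_sub_smul_inv hσ hA
  set P := A * Aᵀ with hPdef
  have hdet := (Matrix.isUnit_iff_isUnit_det P).1 hu
  have hPt : Pᵀ = P := hPh
  -- Orthogonal projection onto the row space of `A`. It separates the two blocks: `EᵀE ≤ σ²(1 - T)`
  -- and `AᵀPA ≥ σ²T`.
  set T := Aᵀ * P⁻¹ * A with hT
  have hTt : Tᵀ = T := by
    rw [hT, Matrix.transpose_mul, Matrix.transpose_mul, Matrix.transpose_nonsing_inv, hPt,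
      Matrix.transpose_transpose, Matrix.mul_assoc]
  have hTT : T * T = T := by
    calc T * T = Aᵀ * (P⁻¹ * P) * P⁻¹ * A := by simp only [hT, hPdef, Matrix.mul_assoc]
      _ = T := by rw [Matrix.nonsing_inv_mul _ hdet, Matrix.mul_one]
  have hTtr : T.trace = Fintype.card m := by
    rw [hT, Matrix.mul_assoc, Matrix.trace_mul_comm, Matrix.mul_assoc, ← hPdef,
      Matrix.nonsing_inv_mul _ hdet, Matrix.trace_one]
  have hET : E * T = 0 := by
    rw [hT, ← Matrix.mul_assoc, ← Matrix.mul_assoc, hEA, Matrix.zero_mul, Matrix.zero_mul]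
  have hTE : T * Eᵀ = 0 := by
    rw [← hTt, ← Matrix.transpose_mul, hET, Matrix.transpose_zero]
  have hR1 : (σ ^ 2 • (1 - T) - Eᵀ * E).PosSemidef := by
    have h1 := hE.conjTranspose_mul_mul_same (1 - T)
    have h2 : (1 - T)ᴴ = 1 - T := by
      rw [Matrix.conjTranspose_eq_transpose_of_trivial, Matrix.transpose_sub,
        Matrix.transpose_one, hTt]
    rw [h2] at h1
    convert h1 using 1
    have h3 : (1 - T) * (Eᵀ * E) * (1 - T) = Eᵀ * E := by
      have h5 : (1 - T) * (Eᵀ * E) = Eᵀ * E := by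
        rw [Matrix.sub_mul, ← Matrix.mul_assoc T, hTE, Matrix.zero_mul, sub_zero, Matrix.one_mul]
      rw [h5, Matrix.mul_sub, Matrix.mul_assoc _ E T, hET, Matrix.mul_zero, sub_zero,
        Matrix.mul_one]
    have h4 : (1 - T) * (1 - T) = 1 - T := by
      rw [Matrix.sub_mul, Matrix.mul_sub, Matrix.mul_sub, hTT]
      simp
    rw [Matrix.mul_sub (1 - T) (σ ^ 2 • 1), Matrix.sub_mul ((1 - T) * (σ ^ 2 • 1)), h3,
      Matrix.mul_smul, Matrix.smul_mul, Matrix.mul_one, h4]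
  have hR2 : (Aᵀ * P * A - σ ^ 2 • T).PosSemidef := by
    have h1 := hP.conjTranspose_mul_mul_same A
    rw [Matrix.mul_sub, Matrix.sub_mul, Matrix.mul_smul, Matrix.smul_mul] at h1
    exact h1
  -- Testing the first block against `Q` and the second against `1 - Q`, the terms in `TQ` cancel
  -- and the gap is at least `σ²(tr T - tr Q) ≥ 0`.
  have t1 := hR1.trace_mul_projection_nonneg hQt hQ
  have hQ' : (1 - Q) * (1 - Q) = 1 - Q := by
    rw [Matrix.sub_mul, Matrix.mul_sub, Matrix.mul_sub, hQ]
    simp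
  have t2 := hR2.trace_mul_projection_nonneg (Q := 1 - Q)
    (by rw [Matrix.transpose_sub, Matrix.transpose_one, hQt]) hQ'
  simp only [Matrix.mul_sub, Matrix.sub_mul, Matrix.smul_mul, Matrix.one_mul, Matrix.mul_one,
    Matrix.trace_sub, Matrix.trace_smul, smul_eq_mul, hTtr, smul_sub] at t1 t2
  rw [Matrix.add_mul, Matrix.trace_add]
  have := mul_le_mul_of_nonneg_left hQr (sq_nonneg σ)
  linarith

theorem frobInner_residual_le_of_curvature_nonneg {Z : Matrix l n ℝ}
    (hBA : Bᵀ * B = A * Aᵀ) (hBE : Bᵀ * (B * A - Z) = 0) (hEA : (B * A - Z) * Aᵀ = 0)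
    (h : ∀ (U : Matrix m n ℝ) (V : Matrix l m ℝ),
      0 ≤ frobInner (B * U + V * A) (B * U + V * A) + 2 * frobInner (B * A - Z) (V * U)
        + μ / 2 * frobInner (Bᵀ * V + Vᵀ * B - A * Uᵀ - U * Aᵀ)
          (Bᵀ * V + Vᵀ * B - A * Uᵀ - U * Aᵀ))
    (B' : Matrix l m ℝ) (A' : Matrix m n ℝ) :
    frobInner (B * A - Z) (B * A - Z) ≤ frobInner (B' * A' - Z) (B' * A' - Z) := by
  classical
  by_cases hE0 : B * A - Z = 0
  · rw [hE0]
    simpa using frobInner_self_nonneg (B' * A' - Z)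
  obtain ⟨σ, u, hσ, hu, hEu, hE⟩ := Matrix.exists_top_singular_value hE0
  have hA : (A * Aᵀ - σ • 1).PosSemidef := by
    refine Matrix.PosSemidef.of_dotProduct_mulVec_nonneg ?_ fun p => ?_
    · exact (Matrix.isHermitian_mul_conjTranspose_self A).sub
        (Matrix.PosDef.one.smul hσ).isHermitian
    · have := singular_value_le_of_curvature_nonneg hBA hBE hEA h hσ hu hEu p
      simp only [star_trivial, Matrix.sub_mulVec, Matrix.smul_mulVec, Matrix.one_mulVec,
        dotProduct_sub, dotProduct_smul, smul_eq_mul]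
      linarith
  obtain ⟨Q, hQt, hQ, hCQ, hQr⟩ := Matrix.exists_rowSpace_projection (B' * A')
  have hQr' : Q.trace ≤ Fintype.card m := by
    rw [hQr]
    exact_mod_cast (Matrix.rank_mul_le_right B' A').trans (Matrix.rank_le_card_height A')
  have key := trace_mul_projection_le hσ hEA hA hE hQt hQ hQr'
  set E := B * A - Z with hEdef
  have hZ : Z = B * A - E := by rw [hEdef, sub_sub_cancel]
  have hEB : Eᵀ * B = 0 := by
    rw [← Matrix.transpose_transpose B, ← Matrix.transpose_mul, hBE, Matrix.transpose_zero]
  have hZZ : Zᵀ * Z = Aᵀ * (A * Aᵀ) * A + Eᵀ * E := by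
    have h1 : Bᵀ * Z = A * Aᵀ * A := by
      rw [hZ, Matrix.mul_sub, hBE, sub_zero, ← Matrix.mul_assoc, hBA]
    have h2 : Eᵀ * Z = - (Eᵀ * E) := by
      rw [hZ, Matrix.mul_sub, ← Matrix.mul_assoc, hEB, Matrix.zero_mul, zero_sub]
    have h3 : Zᵀ = Aᵀ * Bᵀ - Eᵀ := by rw [hZ, Matrix.transpose_sub, Matrix.transpose_mul]
    rw [h3, Matrix.sub_mul, Matrix.mul_assoc, h1, h2, sub_neg_eq_add, ← Matrix.mul_assoc Aᵀ]
  rw [← hZZ] at key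
  have hlow : frobInner (Z * (1 - Q)) (Z * (1 - Q))
      ≤ frobInner (B' * A' - Z) (B' * A' - Z) := by
    -- Pythagoras: `Q` fixes the rows of `B' * A'`, so the part of the error outside `Q` comes from
    -- `Z` alone.
    have h1 : B' * A' - Z = (B' * A' - Z) * Q - Z * (1 - Q) := by
      rw [Matrix.sub_mul, hCQ, Matrix.mul_sub, Matrix.mul_one]
      abel
    have hort : ∀ G : Matrix l n ℝ, frobInner (G * Q) (Z * (1 - Q)) = 0 := fun G => by
      rw [frobInner_mul_right, Matrix.transpose_sub, Matrix.transpose_one, hQt, Matrix.mul_assoc,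
        Matrix.mul_sub, Matrix.mul_one, hQ, sub_self]
      simp
    rw [h1]
    have h2 := hort (B' * A' - Z)
    have h3 := frobInner_self_nonneg ((B' * A' - Z) * Q)
    have h4 := frobInner_comm (Z * (1 - Q)) ((B' * A' - Z) * Q)
    simp only [map_sub, LinearMap.sub_apply] at h2 h3 h4 ⊢
    linarith
  have hval : frobInner (Z * (1 - Q)) (Z * (1 - Q)) = (Zᵀ * Z).trace - (Zᵀ * Z * Q).trace := by
    have h1 : (1 - Q) * (1 - Q)ᵀ = 1 - Q := by
      rw [Matrix.transpose_sub, Matrix.transpose_one, hQt, Matrix.sub_mul, Matrix.mul_sub,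
        Matrix.mul_sub, hQ]
      simp
    rw [frobInner_mul_right, Matrix.mul_assoc, h1, frobInner_comm, frobInner_apply,
      ← Matrix.mul_assoc, Matrix.mul_sub, Matrix.mul_one, Matrix.trace_sub]
  have htr : (Zᵀ * Z).trace = (Aᵀ * (A * Aᵀ) * A).trace + frobInner E E := by
    rw [hZZ, Matrix.trace_add, frobInner_apply]
  linarith

end Curvature

/-! ### Coercivity and existence of minimizers. -/

section Existence

variable {l m n : Type*} [Fintype l] [Fintype m] [Fintype n]

theorem pow_four_le_frobInner_transpose_mul_self (B : Matrix l m ℝ) (i : l) (j : m) :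
    B i j ^ 4 ≤ frobInner (Bᵀ * B) (Bᵀ * B) := by
  have h1 : B i j ^ 2 ≤ (Bᵀ * B) j j := by
    rw [Matrix.mul_apply]
    refine le_of_eq_of_le ?_ (Finset.single_le_sum (f := fun i => Bᵀ j i * B i j)
      (fun i _ => mul_self_nonneg _) (Finset.mem_univ i))
    rw [Matrix.transpose_apply, sq]
  calc B i j ^ 4 = (B i j ^ 2) ^ 2 := by ring
    _ ≤ (Bᵀ * B) j j ^ 2 := by gcongr
    _ ≤ _ := sq_le_frobInner_self _ j j

/-- The cross term `⟨BᵀB, AAᵀ⟩` equals `‖BA‖²`. Hence imbalance and product together bound both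
factors, which is the source of coercivity. -/
theorem frobInner_add_frobInner_gram (A : Matrix m n ℝ) (B : Matrix l m ℝ) :
    frobInner (Bᵀ * B) (Bᵀ * B) + frobInner (A * Aᵀ) (A * Aᵀ)
      = frobInner (Bᵀ * B - A * Aᵀ) (Bᵀ * B - A * Aᵀ) + 2 * frobInner (B * A) (B * A) := by
  have h : frobInner (Bᵀ * B) (A * Aᵀ) = frobInner (B * A) (B * A) := by
    rw [frobInner_mul_right, Matrix.transpose_transpose, Matrix.mul_assoc, frobInner_comm,
      frobInner_mul_left, Matrix.transpose_transpose]
  have h' := frobInner_comm (A * Aᵀ) (Bᵀ * B)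
  simp only [map_sub, LinearMap.sub_apply]
  linarith

theorem frobInner_le_two_mul (P Z : Matrix m n ℝ) :
    frobInner P P ≤ 2 * frobInner (P - Z) (P - Z) + 2 * frobInner Z Z := by
  have h := frobInner_self_nonneg (P - (2 : ℝ) • Z)
  have h' := frobInner_comm Z P
  simp only [map_sub, LinearMap.sub_apply, map_smul, LinearMap.smul_apply, smul_eq_mul] at h ⊢
  linarith

theorem continuous_frobInner_self {T : Type*} [TopologicalSpace T] {f : T → Matrix m n ℝ}
    (hf : Continuous f) : Continuous fun t => frobInner (f t) (f t) := by
  simp_rw [frobInner_self]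
  exact continuous_finsetSum _ fun i _ => continuous_finsetSum _ fun j _ =>
    (hf.matrix_elem i j).pow 2

theorem isCompact_setOf_abs_entry_le (m n : Type*) (R : ℝ) :
    IsCompact {A : Matrix m n ℝ | ∀ i j, |A i j| ≤ R} := by
  have : {A : Matrix m n ℝ | ∀ i j, |A i j| ≤ R}
      = Set.pi Set.univ fun _ => Set.pi Set.univ fun _ => Set.Icc (-R) R := by
    ext A
    simp only [Set.mem_ofPred_eq, abs_le]
    exact ⟨fun h i _ j _ => h i j, fun h i j => h i trivial j trivial⟩
  rw [this]
  exact isCompact_univ_pi fun _ => isCompact_univ_pi fun _ => isCompact_Icc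

theorem exists_forall_regularized_le (Z : Matrix l n ℝ) {μ : ℝ} (hμ : 0 < μ) :
    ∃ (A : Matrix m n ℝ) (B : Matrix l m ℝ), ∀ (A' : Matrix m n ℝ) (B' : Matrix l m ℝ),
      1 / 2 * frobInner (B * A - Z) (B * A - Z)
          + μ / 4 * frobInner (Bᵀ * B - A * Aᵀ) (Bᵀ * B - A * Aᵀ)
        ≤ 1 / 2 * frobInner (B' * A' - Z) (B' * A' - Z)
          + μ / 4 * frobInner (B'ᵀ * B' - A' * A'ᵀ) (B'ᵀ * B' - A' * A'ᵀ) := by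
  set Φ : Matrix m n ℝ × Matrix l m ℝ → ℝ := fun p =>
    1 / 2 * frobInner (p.2 * p.1 - Z) (p.2 * p.1 - Z)
      + μ / 4 * frobInner (p.2ᵀ * p.2 - p.1 * p.1ᵀ) (p.2ᵀ * p.2 - p.1 * p.1ᵀ) with hΦ
  have hcont : Continuous Φ := by
    refine (continuous_const.mul (continuous_frobInner_self ?_)).add
      (continuous_const.mul (continuous_frobInner_self ?_)) <;> fun_prop
  set z := frobInner Z Z
  have hz : 0 ≤ z := frobInner_self_nonneg Z
  have hΦ0 : Φ (0, 0) = 1 / 2 * z := by simp [hΦ, z]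
  -- On the sublevel set of the origin the imbalance is at most `2z/μ` and `‖BA - Z‖² ≤ z`, so
  -- `2‖BA‖² ≤ 8z`.
  set C := 2 * z / μ + 8 * z with hC
  have hC0 : 0 ≤ C := by positivity
  have hbound : ∀ p, Φ p ≤ Φ (0, 0) →
      (∀ i j, |p.1 i j| ≤ 1 + C) ∧ (∀ i j, |p.2 i j| ≤ 1 + C) := by
    rintro ⟨A, B⟩ hp
    rw [hΦ0] at hp
    simp only [hΦ] at hp
    have h1 := frobInner_self_nonneg (B * A - Z)
    have h2 := frobInner_self_nonneg (Bᵀ * B - A * Aᵀ)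
    have h2' : 0 ≤ μ / 4 * frobInner (Bᵀ * B - A * Aᵀ) (Bᵀ * B - A * Aᵀ) := by positivity
    have h3 : frobInner (Bᵀ * B - A * Aᵀ) (Bᵀ * B - A * Aᵀ) ≤ 2 * z / μ := by
      rw [le_div_iff₀ hμ]
      linarith
    have h4 := frobInner_le_two_mul (B * A) Z
    have h5 := frobInner_add_frobInner_gram A B
    have h6 := frobInner_self_nonneg (Bᵀ * B)
    have h7 := frobInner_self_nonneg (A * Aᵀ)
    have hx : ∀ x : ℝ, x ^ 4 ≤ C → |x| ≤ 1 + C := fun x hx => by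
      by_contra! h
      have := le_self_pow₀ (a := |x|) (n := 4) (by linarith) (by norm_num)
      have h8 : |x| ^ 4 = x ^ 4 := by rw [← abs_pow]; exact abs_of_nonneg (by positivity)
      linarith
    refine ⟨fun i j => hx _ ?_, fun i j => hx _ ?_⟩
    · have h8 := pow_four_le_frobInner_transpose_mul_self Aᵀ j i
      rw [Matrix.transpose_transpose, Matrix.transpose_apply] at h8
      linarith
    · have h8 := pow_four_le_frobInner_transpose_mul_self B i j
      linarith
  have h0 : ((0, 0) : Matrix m n ℝ × Matrix l m ℝ) ∈
      {A : Matrix m n ℝ | ∀ i j, |A i j| ≤ 1 + C} ×ˢ {B : Matrix l m ℝ | ∀ i j, |B i j| ≤ 1 + C} :=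
    hbound _ le_rfl
  obtain ⟨p, -, hp⟩ := ((isCompact_setOf_abs_entry_le m n _).prod
    (isCompact_setOf_abs_entry_le l m _)).exists_isMinOn ⟨_, h0⟩ hcont.continuousOn
  refine ⟨p.1, p.2, fun A' B' => ?_⟩
  change Φ p ≤ Φ (A', B')
  by_cases hle : Φ (A', B') ≤ Φ (0, 0)
  · exact hp (hbound _ hle)
  · exact (hp h0).trans (not_le.1 hle).le

end Existence

/-! ### The losses in the coordinates `A = W₁ S`, `B = W₂`. -/

section Loss

variable {d₀ d₁ d₂ N : ℕ}

/-- The polarization of `(W₁, W₂) ↦ (W₂ W₁ S, W₂ᵀ W₂ - W₁ S Sᵀ W₁ᵀ)`. -/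
noncomputable def lossPolarForm (S : Matrix (Fin d₀) (Fin d₀) ℝ) :
    Weights d₀ d₁ d₂ →ₗ[ℝ] Weights d₀ d₁ d₂ →ₗ[ℝ]
      (Matrix (Fin d₂) (Fin d₀) ℝ × Matrix (Fin d₁) (Fin d₁) ℝ) :=
  LinearMap.mk₂ ℝ
    (fun W V => (1 / 2 : ℝ) • (W.2 * (V.1 * S) + V.2 * (W.1 * S),
      W.2ᵀ * V.2 + V.2ᵀ * W.2 - W.1 * S * (V.1 * S)ᵀ - V.1 * S * (W.1 * S)ᵀ))
    (fun W W' V => by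
      rw [← smul_add]
      congr 1
      ext1 <;> simp only [Prod.fst_add, Prod.snd_add, Matrix.add_mul, Matrix.mul_add,
        Matrix.transpose_add] <;> abel)
    (fun c W V => by
      rw [smul_comm c]
      congr 1
      ext1 <;> simp only [Prod.smul_fst, Prod.smul_snd, Matrix.smul_mul, Matrix.mul_smul,
        Matrix.transpose_smul, smul_add, smul_sub])
    (fun W V V' => by
      rw [← smul_add]
      congr 1
      ext1 <;> simp only [Prod.fst_add, Prod.snd_add, Matrix.add_mul, Matrix.mul_add,
        Matrix.transpose_add] <;> abel)
    (fun c W V => by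
      rw [smul_comm c]
      congr 1
      ext1 <;> simp only [Prod.smul_fst, Prod.smul_snd, Matrix.smul_mul, Matrix.mul_smul,
        Matrix.transpose_smul, smul_add, smul_sub])

theorem lossPolarForm_apply (S : Matrix (Fin d₀) (Fin d₀) ℝ) (W V : Weights d₀ d₁ d₂) :
    lossPolarForm S W V = (1 / 2 : ℝ) • (W.2 * (V.1 * S) + V.2 * (W.1 * S),
      W.2ᵀ * V.2 + V.2ᵀ * W.2 - W.1 * S * (V.1 * S)ᵀ - V.1 * S * (W.1 * S)ᵀ) := rfl

theorem lossPolarForm_comm (S : Matrix (Fin d₀) (Fin d₀) ℝ) (W V : Weights d₀ d₁ d₂) :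
    lossPolarForm S W V = lossPolarForm S V W := by
  rw [lossPolarForm_apply, lossPolarForm_apply]
  congr 1
  ext1
  · exact add_comm _ _
  · simp only
    abel

theorem lossPolarForm_self (S : Matrix (Fin d₀) (Fin d₀) ℝ) (W : Weights d₀ d₁ d₂) :
    lossPolarForm S W W = (W.2 * (W.1 * S), W.2ᵀ * W.2 - W.1 * S * (W.1 * S)ᵀ) := by
  rw [lossPolarForm_apply]
  ext1
  · simp only [Prod.smul_fst]
    module
  · simp only [Prod.smul_snd]
    module

/-- The weighted Frobenius inner product on pairs of matrices. -/
noncomputable def pairInner {l m n : Type*} [Fintype l] [Fintype m] [Fintype n] (μ : ℝ) :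
    (Matrix l n ℝ × Matrix m m ℝ) →ₗ[ℝ] (Matrix l n ℝ × Matrix m m ℝ) →ₗ[ℝ] ℝ :=
  frobInner.compl₁₂ (LinearMap.fst ℝ _ _) (LinearMap.fst ℝ _ _)
    + (μ / 2) • frobInner.compl₁₂ (LinearMap.snd ℝ _ _) (LinearMap.snd ℝ _ _)

theorem pairInner_apply {l m n : Type*} [Fintype l] [Fintype m] [Fintype n] (μ : ℝ)
    (x y : Matrix l n ℝ × Matrix m m ℝ) :
    pairInner μ x y = frobInner x.1 y.1 + μ / 2 * frobInner x.2 y.2 := rfl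

theorem pairInner_comm {l m n : Type*} [Fintype l] [Fintype m] [Fintype n] (μ : ℝ)
    (x y : Matrix l n ℝ × Matrix m m ℝ) : pairInner μ x y = pairInner μ y x := by
  rw [pairInner_apply, pairInner_apply, frobInner_comm x.1, frobInner_comm x.2]

theorem quarticMap_lossPolarForm (S : Matrix (Fin d₀) (Fin d₀) ℝ) (Z : Matrix (Fin d₂) (Fin d₀) ℝ)
    (μ k : ℝ) (W : Weights d₀ d₁ d₂) :
    quarticMap (lossPolarForm S) (pairInner μ) (Z, 0) k W
      = 1 / 2 * frobInner (W.2 * (W.1 * S) - Z) (W.2 * (W.1 * S) - Z)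
        + μ / 4 * frobInner (W.2ᵀ * W.2 - W.1 * S * (W.1 * S)ᵀ)
          (W.2ᵀ * W.2 - W.1 * S * (W.1 * S)ᵀ) + k := by
  rw [quarticMap, lossPolarForm_self, pairInner_apply]
  simp only [Prod.fst_sub, Prod.snd_sub, sub_zero]
  ring

theorem quarticGrad_lossPolarForm (S : Matrix (Fin d₀) (Fin d₀) ℝ)
    (Z : Matrix (Fin d₂) (Fin d₀) ℝ) (μ : ℝ) (W V : Weights d₀ d₁ d₂) :
    quarticGrad (lossPolarForm S) (pairInner μ) (Z, 0) W V
      = frobInner (W.2 * (W.1 * S) - Z) (W.2 * (V.1 * S) + V.2 * (W.1 * S))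
        + μ / 2 * frobInner (W.2ᵀ * W.2 - W.1 * S * (W.1 * S)ᵀ)
          (W.2ᵀ * V.2 + V.2ᵀ * W.2 - W.1 * S * (V.1 * S)ᵀ - V.1 * S * (W.1 * S)ᵀ) := by
  rw [quarticGrad_apply, lossPolarForm_self, lossPolarForm_apply, map_smul, pairInner_apply,
    smul_eq_mul]
  simp only [Prod.fst_sub, Prod.snd_sub, sub_zero]
  ring

theorem quarticHess_lossPolarForm {S : Matrix (Fin d₀) (Fin d₀) ℝ}
    {Z : Matrix (Fin d₂) (Fin d₀) ℝ} {μ : ℝ} {W : Weights d₀ d₁ d₂}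
    (hW : W.2ᵀ * W.2 = W.1 * S * (W.1 * S)ᵀ) (V : Weights d₀ d₁ d₂) :
    quarticHess (lossPolarForm S) (pairInner μ) (Z, 0) W V V
      = frobInner (W.2 * (V.1 * S) + V.2 * (W.1 * S)) (W.2 * (V.1 * S) + V.2 * (W.1 * S))
        + 2 * frobInner (W.2 * (W.1 * S) - Z) (V.2 * (V.1 * S))
        + μ / 2 * frobInner
          (W.2ᵀ * V.2 + V.2ᵀ * W.2 - W.1 * S * (V.1 * S)ᵀ - V.1 * S * (W.1 * S)ᵀ)
          (W.2ᵀ * V.2 + V.2ᵀ * W.2 - W.1 * S * (V.1 * S)ᵀ - V.1 * S * (W.1 * S)ᵀ) := by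
  rw [quarticHess_apply, lossPolarForm_self, lossPolarForm_self, lossPolarForm_apply, hW, sub_self,
    map_smul, LinearMap.map_smul₂, pairInner_apply, pairInner_apply]
  simp only [Prod.fst_sub, Prod.snd_sub, sub_zero, smul_eq_mul, map_zero, LinearMap.zero_apply]
  ring

/-- Completing the square: `Z` is chosen so that `Z Sᵀ = Y Xᵀ`. Neither `Z` nor `k` depends on `μ`,
which allows `f` and `g` to be compared. -/
theorem regLoss_eq_quarticMap {X : Matrix (Fin d₀) (Fin N) ℝ} {S : Matrix (Fin d₀) (Fin d₀) ℝ}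
    (hS : IsUnit S) (hX : S * Sᵀ = X * Xᵀ) (Y : Matrix (Fin d₂) (Fin N) ℝ) :
    ∃ (Z : Matrix (Fin d₂) (Fin d₀) ℝ) (k : ℝ), ∀ μ : ℝ,
      regLoss d₁ X Y μ = quarticMap (lossPolarForm S) (pairInner μ) (Z, 0) k := by
  have hdet := (Matrix.isUnit_iff_isUnit_det S).1 hS
  have hdett : IsUnit Sᵀ.det := by rwa [Matrix.det_transpose]
  set Z := Y * Xᵀ * Sᵀ⁻¹ with hZ
  refine ⟨Z, 1 / 2 * frobInner Y Y - 1 / 2 * frobInner Z Z, fun μ => ?_⟩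
  funext W
  rw [quarticMap_lossPolarForm, regLoss, squareLoss, balanceReg, frobeniusNorm_sq,
    frobeniusNorm_sq]
  have h1 : W.1 * X * Xᵀ * W.1ᵀ = W.1 * S * (W.1 * S)ᵀ := by
    rw [Matrix.mul_assoc W.1, ← hX, Matrix.transpose_mul]
    simp only [Matrix.mul_assoc]
  have h2 : frobInner (W.2 * W.1 * X) (W.2 * W.1 * X)
      = frobInner (W.2 * (W.1 * S)) (W.2 * (W.1 * S)) := by
    rw [← Matrix.mul_assoc W.2, frobInner_mul_right (W.2 * W.1) X,
      frobInner_mul_right (W.2 * W.1) S, Matrix.mul_assoc _ X, Matrix.mul_assoc _ S, hX]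
  have h3 : frobInner (W.2 * W.1 * X) Y = frobInner (W.2 * (W.1 * S)) Z := by
    rw [← Matrix.mul_assoc W.2, frobInner_comm, frobInner_comm _ Z,
      frobInner_mul_right (W.2 * W.1) X, frobInner_mul_right (W.2 * W.1) S, hZ,
      Matrix.nonsing_inv_mul_cancel_right _ _ hdett]
  have h4 := frobInner_comm Y (W.2 * W.1 * X)
  have h5 := frobInner_comm Z (W.2 * (W.1 * S))
  rw [h1]
  simp only [map_sub, LinearMap.sub_apply] at *
  linarith

theorem regLoss_zero (X : Matrix (Fin d₀) (Fin N) ℝ) (Y : Matrix (Fin d₂) (Fin N) ℝ) :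
    regLoss d₁ X Y 0 = squareLoss d₁ X Y := by
  funext W
  simp [regLoss]

variable {S : Matrix (Fin d₀) (Fin d₀) ℝ} {Z : Matrix (Fin d₂) (Fin d₀) ℝ} {μ k : ℝ}
  {W : Weights d₀ d₁ d₂}

theorem balanced_of_quarticGrad_eq_zero (hS : IsUnit S) (hμ : 0 < μ)
    (hW : ∀ V, quarticGrad (lossPolarForm S) (pairInner μ) (Z, 0) W V = 0) :
    W.2ᵀ * W.2 = W.1 * S * (W.1 * S)ᵀ := by
  refine balanced_of_stationary (Z := Z) hμ fun U V => ?_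
  -- Invertibility of `S` makes every `U` available as a variation of `W₁ S`.
  have := hW (U * S⁻¹, V)
  rw [quarticGrad_lossPolarForm] at this
  simpa only [Matrix.nonsing_inv_mul_cancel_right _ U ((Matrix.isUnit_iff_isUnit_det S).1 hS)]
    using this

theorem quarticGrad_zero_eq_zero (hS : IsUnit S) (hμ : 0 < μ)
    (hW : ∀ V, quarticGrad (lossPolarForm S) (pairInner μ) (Z, 0) W V = 0)
    (V : Weights d₀ d₁ d₂) :
    quarticGrad (lossPolarForm S) (pairInner 0) (Z, 0) W V = 0 := by
  have h1 := hW V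
  rw [quarticGrad_lossPolarForm, balanced_of_quarticGrad_eq_zero hS hμ hW] at h1
  rw [quarticGrad_lossPolarForm]
  simpa using h1

theorem quarticMap_eq_of_balanced (hW : W.2ᵀ * W.2 = W.1 * S * (W.1 * S)ᵀ) :
    quarticMap (lossPolarForm S) (pairInner μ) (Z, 0) k W
      = quarticMap (lossPolarForm S) (pairInner 0) (Z, 0) k W := by
  rw [quarticMap_lossPolarForm, quarticMap_lossPolarForm, hW]
  simp

theorem quarticMap_zero_le (hμ : 0 ≤ μ) (W : Weights d₀ d₁ d₂) :
    quarticMap (lossPolarForm S) (pairInner 0) (Z, 0) k W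
      ≤ quarticMap (lossPolarForm S) (pairInner μ) (Z, 0) k W := by
  rw [quarticMap_lossPolarForm, quarticMap_lossPolarForm]
  have := mul_nonneg hμ (frobInner_self_nonneg (W.2ᵀ * W.2 - W.1 * S * (W.1 * S)ᵀ))
  linarith

/-- Bounding the regularized value by the unregularized one at every `W'` serves both the equality
of minimum values and the absence of spurious minima. -/
theorem quarticMap_zero_le_of_hess_nonneg (hS : IsUnit S) (hμ : 0 < μ)
    (hW : ∀ V, quarticGrad (lossPolarForm S) (pairInner μ) (Z, 0) W V = 0)
    (hH : ∀ V, 0 ≤ quarticHess (lossPolarForm S) (pairInner μ) (Z, 0) W V V)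
    (W' : Weights d₀ d₁ d₂) :
    quarticMap (lossPolarForm S) (pairInner μ) (Z, 0) k W
      ≤ quarticMap (lossPolarForm S) (pairInner 0) (Z, 0) k W' := by
  have hdet := (Matrix.isUnit_iff_isUnit_det S).1 hS
  have hb := balanced_of_quarticGrad_eq_zero hS hμ hW
  have hst : ∀ (U : Matrix (Fin d₁) (Fin d₀) ℝ) (V : Matrix (Fin d₂) (Fin d₁) ℝ),
      frobInner (W.2 * (W.1 * S) - Z) (W.2 * U + V * (W.1 * S)) = 0 := fun U V => by
    have := hW (U * S⁻¹, V)
    rw [quarticGrad_lossPolarForm, hb] at this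
    simpa [Matrix.nonsing_inv_mul_cancel_right _ U hdet] using this
  obtain ⟨h1, h2⟩ := transpose_mul_eq_zero_of_stationary hst
  have key := frobInner_residual_le_of_curvature_nonneg (μ := μ) hb h1 h2 (fun U V => by
    have := hH (U * S⁻¹, V)
    rw [quarticHess_lossPolarForm hb] at this
    simpa only [Matrix.nonsing_inv_mul_cancel_right _ U hdet] using this) W'.2 (W'.1 * S)
  rw [quarticMap_eq_of_balanced hb, quarticMap_lossPolarForm, quarticMap_lossPolarForm]
  linarith

theorem exists_isGlobalMin_quarticMap (hS : IsUnit S) (hμ : 0 < μ) :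
    ∃ W : Weights d₀ d₁ d₂,
      IsGlobalMin (quarticMap (lossPolarForm S) (pairInner μ) (Z, 0) k) W := by
  obtain ⟨A, B, h⟩ := exists_forall_regularized_le (m := Fin d₁) Z hμ
  refine ⟨(A * S⁻¹, B), fun W' => ?_⟩
  rw [quarticMap_lossPolarForm, quarticMap_lossPolarForm,
    Matrix.nonsing_inv_mul_cancel_right _ A ((Matrix.isUnit_iff_isUnit_det S).1 hS)]
  have := h (W'.1 * S) W'.2
  linarith

end Loss

theorem theorem1 (d₀ d₁ d₂ N : ℕ) (X : Matrix (Fin d₀) (Fin N) ℝ) (Y : Matrix (Fin d₂) (Fin N) ℝ)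
    (hX : (X * X.transpose).rank = d₀) (μ : ℝ) (hμ : 0 < μ) :
    (∃ v : ℝ, IsLeast (Set.range (squareLoss d₁ X Y)) v ∧
      IsLeast (Set.range (regLoss d₁ X Y μ)) v) ∧
    (∀ W : Weights d₀ d₁ d₂, IsCriticalPt (regLoss d₁ X Y μ) W →
      IsCriticalPt (squareLoss d₁ X Y) W) ∧
    ((¬ ∃ W : Weights d₀ d₁ d₂, IsSpuriousLocalMin (regLoss d₁ X Y μ) W) ∧
      ∀ W : Weights d₀ d₁ d₂, IsSaddlePt (regLoss d₁ X Y μ) W →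
        ∃ c : ℝ, c < 0 ∧
          Module.End.HasEigenvalue (Matrix.toLin' (hessianMatrix (regLoss d₁ X Y μ) W)) c) := by
  obtain ⟨S, hS, hSX⟩ := Matrix.exists_factor_of_rank_eq hX
  obtain ⟨Z, k, hZ⟩ := regLoss_eq_quarticMap (d₁ := d₁) hS hSX Y
  rw [← regLoss_zero X Y, hZ 0, hZ μ]
  have hq := lossPolarForm_comm (d₁ := d₁) (d₂ := d₂) S
  have hβ : ∀ μ : ℝ, _ := fun μ => pairInner_comm (l := Fin d₂) (m := Fin d₁) (n := Fin d₀) μ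
  have hmin : ∀ W, IsLocalMin (quarticMap (lossPolarForm S) (pairInner μ) (Z, 0) k) W →
      ∀ W' : Weights d₀ d₁ d₂, quarticMap (lossPolarForm S) (pairInner μ) (Z, 0) k W
        ≤ quarticMap (lossPolarForm S) (pairInner 0) (Z, 0) k W' := fun W hW =>
    quarticMap_zero_le_of_hess_nonneg hS hμ (quarticGrad_eq_zero_of_isLocalMin hq (hβ μ) hW)
      (quarticHess_nonneg_of_isLocalMin hq (hβ μ) hW)
  refine ⟨?_, fun W hW => ?_, ?_, fun W hW => ?_⟩
  · obtain ⟨W, hW⟩ := exists_isGlobalMin_quarticMap (d₁ := d₁) (Z := Z) (k := k) hS hμ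
    have hloc : IsLocalMin (quarticMap (lossPolarForm S) (pairInner μ) (Z, 0) k) W :=
      Filter.Eventually.of_forall hW
    refine ⟨_, ⟨⟨W, ?_⟩, ?_⟩, ⟨⟨W, rfl⟩, ?_⟩⟩
    · exact (quarticMap_eq_of_balanced (balanced_of_quarticGrad_eq_zero hS hμ
        (quarticGrad_eq_zero_of_isLocalMin hq (hβ μ) hloc))).symm
    · rintro _ ⟨W', rfl⟩
      exact hmin W hloc W'
    · rintro _ ⟨W', rfl⟩
      exact hW W'
  · rw [isCriticalPt_quarticMap_iff hq (hβ _)] at hW ⊢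
    exact quarticGrad_zero_eq_zero hS hμ hW
  · rintro ⟨W, hW, hn⟩
    exact hn fun W' => (hmin W hW W').trans (quarticMap_zero_le hμ.le W')
  · obtain ⟨hc, hn⟩ := hW
    rw [isCriticalPt_quarticMap_iff hq (hβ _)] at hc
    -- Without a negative eigenvalue the Hessian form is nonnegative, so the critical point would be
    -- a global minimum, hence a local one.
    by_contra hne
    refine hn (Filter.Eventually.of_forall fun W' => ?_)
    refine (quarticMap_zero_le_of_hess_nonneg hS hμ hc (fun V => ?_) W').trans
      (quarticMap_zero_le hμ.le W')
    by_contra! hV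
    exact hne (exists_neg_eigenvalue_hessianMatrix hq (hβ _) hV)
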